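/- Let $H$ be a complex Hilbert space. A bounded linear operator $A$ on $H$ is called positive if $(Ax\mid x)\ge 0$ for all $x\in H$; for positive operators write $A\le B$ if $(Ax\mid x)\le (Bx\mid x)$ for all $x\in H$, and say that $A$ is dominated by $B$ if $A\le cB$ for some constant $c$. For bounded positive operators $A$ and $B$: - $A_{\ll,B}$ denotes the unique bounded positive operator with $$(A_{\ll,B}\,x\mid x)=\inf_{y\in\ker B}(A(x-y)\mid x-y)\qquad(x\in H),$$ i.e. the short of $A$ to $\ker B$ (the absolutely continuous part of $A$ with respect to $B$); - the parallel sum $A:B$ is the unique bounded positive operator with $$((A:B)x\mid x)=\inf_{y\in H}\big\{(A(x-y)\mid x-y)+(By\mid y)\big\}\qquad(x\in H);$$ - $\mathbf D_BA:=\sup_{n\in\mathbb N}\,(A:nB)$, the supremum being taken with respect to $\le$. Corollary (characterization of closed range positive operators). Let $B$ be a bounded positive operator on $H$. Then the following are equivalent: (i) $\operatorname{ran}B$ is closed; (ii) $A_{\ll,B}$ is dominated by $B$ for every bounded positive operator $A$ on $H$; (iii) $\mathbf D_BA$ is dominated by $B$ for every bounded positive operator $A$ on $H$. If any of (i)–(iii)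 holds, then $\mathbf D_BA=A_{\ll,B}$ for every bounded positive operator $A$ on $H$. -/

import Mathlib

/-!  Bounded positive operators on a complex Hilbert space `H`: mathlib's
`ContinuousLinearMap.IsPositive`; the relation `≤` is mathlib's Loewner order.  The value at `x` of
the quadratic form of `A` is `A.reApplyInnerSelf x = re ⟪A x, x⟫`. -/

namespace PosOp

variable {H : Type*} [NormedAddCommGroup H] [InnerProductSpace ℂ H] [CompleteSpace H]

/-- `A` is dominated by `B`: `A ≤ c • B` for some constant `c`. -/
def DominatedBy (A B : H →L[ℂ] H) : Prop := ∃ c : ℝ, A ≤ c • B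

/-! ### Existence of the operators attached to infima of quadratic forms -/

theorem sqrt_isPositive (A : H →L[ℂ] H) : (CFC.sqrt A).IsPositive :=
  (ContinuousLinearMap.nonneg_iff_isPositive _).1 (CFC.sqrt_nonneg A)

theorem norm_sqrt_apply_sq {A : H →L[ℂ] H} (hA : A.IsPositive) (x : H) :
    ‖CFC.sqrt A x‖ ^ 2 = A.reApplyInnerSelf x := by
  have h : CFC.sqrt A * CFC.sqrt A = A :=
    CFC.sqrt_mul_sqrt_self A ((ContinuousLinearMap.nonneg_iff_isPositive _).2 hA)
  have h2 : A x = CFC.sqrt A (CFC.sqrt A x) := by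
    conv_lhs => rw [← h]
    rfl
  rw [ContinuousLinearMap.reApplyInnerSelf_apply, h2,
    (sqrt_isPositive A).inner_left_eq_inner_right, inner_self_eq_norm_sq]

/-- A positive operator is determined by its quadratic form. -/
theorem eq_of_reApplyInnerSelf_eq {S T : H →L[ℂ] H} (hS : S.IsPositive) (hT : T.IsPositive)
    (h : ∀ x, S.reApplyInnerSelf x = T.reApplyInnerSelf x) : S = T := by
  apply le_antisymm
  · rw [ContinuousLinearMap.le_def]
    refine ⟨hT.isSymmetric.sub hS.isSymmetric, fun x => ?_⟩
    have := h x
    simp only [ContinuousLinearMap.reApplyInnerSelf_apply, sub_apply,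
      inner_sub_left, map_sub] at this ⊢
    linarith
  · rw [ContinuousLinearMap.le_def]
    refine ⟨hS.isSymmetric.sub hT.isSymmetric, fun x => ?_⟩
    have := h x
    simp only [ContinuousLinearMap.reApplyInnerSelf_apply, sub_apply,
      inner_sub_left, map_sub] at this ⊢
    linarith

/-- Between positive operators, the Loewner order is the pointwise order of quadratic forms. -/
theorem le_iff_reApplyInnerSelf_le {S T : H →L[ℂ] H} (hS : S.IsPositive) (hT : T.IsPositive) :
    S ≤ T ↔ ∀ x, S.reApplyInnerSelf x ≤ T.reApplyInnerSelf x := by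
  rw [ContinuousLinearMap.le_def]
  have key : ∀ x, (T - S).reApplyInnerSelf x = T.reApplyInnerSelf x - S.reApplyInnerSelf x := by
    intro x
    simp only [ContinuousLinearMap.reApplyInnerSelf_apply, sub_apply,
      inner_sub_left, map_sub]
  constructor
  · intro h x
    have := h.2 x
    rw [key] at this
    linarith
  · intro h
    refine ⟨hT.isSymmetric.sub hS.isSymmetric, fun x => ?_⟩
    rw [key]
    linarith [h x]

theorem exists_operator_of_isGLB {F : Type*} [NormedAddCommGroup F] [InnerProductSpace ℂ F]
    [CompleteSpace F] (T : H →L[ℂ] F) (K : Submodule ℂ F) :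
    ∃ S : H →L[ℂ] H, S.IsPositive ∧
      ∀ x, IsGLB (Set.range fun k : K => ‖T x - k‖ ^ 2) (S.reApplyInnerSelf x) := by
  set L : Submodule ℂ F := K.topologicalClosure with hL
  have : CompleteSpace L := K.isClosed_topologicalClosure.completeSpace_coe
  have hP : (Lᗮ.starProjection).IsPositive :=
    ContinuousLinearMap.IsPositive.of_isStarProjection isStarProjection_starProjection
  refine ⟨T.adjoint ∘L Lᗮ.starProjection ∘L T, hP.adjoint_conj T, fun x => ?_⟩
  have hval : (T.adjoint ∘L Lᗮ.starProjection ∘L T).reApplyInnerSelf x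
      = ‖T x - L.starProjection (T x)‖ ^ 2 := by
    rw [ContinuousLinearMap.reApplyInnerSelf_apply, ContinuousLinearMap.comp_apply,
      ContinuousLinearMap.comp_apply, ContinuousLinearMap.adjoint_inner_left,
      Submodule.starProjection_orthogonal_val, ← inner_self_eq_norm_sq (𝕜 := ℂ)]
    have horth : inner ℂ (T x - L.starProjection (T x)) (L.starProjection (T x)) = 0 :=
      L.starProjection_inner_eq_zero _ _ (L.starProjection_apply_mem _)
    rw [inner_sub_right, horth, sub_zero]
  rw [hval]
  constructor
  · rintro _ ⟨k, rfl⟩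
    have hk : (k : F) ∈ L := K.le_topologicalClosure k.2
    have h1 : ‖T x - L.starProjection (T x)‖ ≤ ‖T x - k‖ := by
      rw [L.starProjection_minimal]
      exact ciInf_le ⟨0, Set.forall_mem_range.2 fun _ => norm_nonneg _⟩ (⟨k, hk⟩ : L)
    exact pow_le_pow_left₀ (norm_nonneg _) h1 2
  · intro b hb
    have hcl : IsClosed {z : F | b ≤ ‖T x - z‖ ^ 2} :=
      isClosed_le continuous_const (by fun_prop)
    have hsub : (K : Set F) ⊆ {z : F | b ≤ ‖T x - z‖ ^ 2} :=
      fun k hk => hb ⟨⟨k, hk⟩, rfl⟩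
    exact closure_minimal hsub hcl (L.starProjection_apply_mem (T x))

/-! ### The short of an operator and the absolutely continuous part -/

theorem exists_short {A : H →L[ℂ] H} (hA : A.IsPositive) (Y : Submodule ℂ H) :
    ∃ S : H →L[ℂ] H, S.IsPositive ∧
      ∀ x, S.reApplyInnerSelf x = ⨅ y : Y, A.reApplyInnerSelf (x - y) := by
  obtain ⟨S, hS, h⟩ := exists_operator_of_isGLB (CFC.sqrt A)
    (Y.map (CFC.sqrt A : H →L[ℂ] H).toLinearMap)
  refine ⟨S, hS, fun x => ?_⟩
  have hr : (Set.range fun k : Y.map (CFC.sqrt A : H →L[ℂ] H).toLinearMap =>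
      ‖CFC.sqrt A x - k‖ ^ 2) = Set.range fun y : Y => A.reApplyInnerSelf (x - y) := by
    ext r
    constructor
    · rintro ⟨⟨_, y, hy, rfl⟩, rfl⟩
      refine ⟨⟨y, hy⟩, ?_⟩
      simp only [← norm_sqrt_apply_sq hA, map_sub]
      rfl
    · rintro ⟨⟨y, hy⟩, rfl⟩
      refine ⟨⟨_, y, hy, rfl⟩, ?_⟩
      simp only [← norm_sqrt_apply_sq hA, map_sub]
      rfl
  have hx := h x
  rw [hr] at hx
  exact (hx.csInf_eq (Set.range_nonempty _)).symm

/-- The short of the quadratic form of `A` to the subspace `Y`, as an operator: the (unique)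
positive operator whose quadratic form is `x ↦ inf {⟪A (x - y), x - y⟫ | y ∈ Y}`. -/
noncomputable def short {A : H →L[ℂ] H} (hA : A.IsPositive) (Y : Submodule ℂ H) : H →L[ℂ] H :=
  (exists_short hA Y).choose

theorem short_isPositive {A : H →L[ℂ] H} (hA : A.IsPositive) (Y : Submodule ℂ H) :
    (short hA Y).IsPositive :=
  (exists_short hA Y).choose_spec.1

theorem short_reApplyInnerSelf {A : H →L[ℂ] H} (hA : A.IsPositive) (Y : Submodule ℂ H) (x : H) :
    (short hA Y).reApplyInnerSelf x = ⨅ y : Y, A.reApplyInnerSelf (x - y) :=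
  (exists_short hA Y).choose_spec.2 x

/-- For positive `B`, the kernel of `B` is the kernel of its quadratic form. -/
theorem mem_ker_iff_reApplyInnerSelf_eq_zero {B : H →L[ℂ] H} (hB : B.IsPositive) (x : H) :
    x ∈ B.ker ↔ B.reApplyInnerSelf x = 0 := by
  constructor
  · intro h
    have h0 : B x = 0 := h
    simp [ContinuousLinearMap.reApplyInnerSelf_apply, h0]
  · intro h
    have hmul : CFC.sqrt B * CFC.sqrt B = B :=
      CFC.sqrt_mul_sqrt_self B ((ContinuousLinearMap.nonneg_iff_isPositive _).2 hB)
    have h1 : CFC.sqrt B x = 0 := by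
      rw [← norm_sqrt_apply_sq hB] at h
      simpa using h
    have h2 : B x = CFC.sqrt B (CFC.sqrt B x) := by
      conv_lhs => rw [← hmul]
      rfl
    change B x = 0
    rw [h2, h1, map_zero]

/-- The absolutely continuous part of `A` with respect to `B` in the short-type decomposition: the
short of the form of `A` to `ker B` (which, for positive `B`, is the kernel of the form of `B`). -/
noncomputable def acPart {A : H →L[ℂ] H} (hA : A.IsPositive) (B : H →L[ℂ] H) : H →L[ℂ] H :=
  short hA B.ker

/-! ### Parallel sums and Ando's almost dominated part -/

theorem exists_parallelSum {A B : H →L[ℂ] H} (hA : A.IsPositive) (hB : B.IsPositive) :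
    ∃ S : H →L[ℂ] H, S.IsPositive ∧
      ∀ x, S.reApplyInnerSelf x = ⨅ y : H, (A.reApplyInnerSelf (x - y) + B.reApplyInnerSelf y) := by
  let J : H × H →L[ℂ] WithLp 2 (H × H) :=
    (WithLp.prodContinuousLinearEquiv 2 ℂ H H).symm.toContinuousLinearMap
  let T : H →L[ℂ] WithLp 2 (H × H) := J ∘L (CFC.sqrt A).prod 0
  let R : H →L[ℂ] WithLp 2 (H × H) := J ∘L (CFC.sqrt A).prod (CFC.sqrt B)
  have key : ∀ x y, ‖T x - R y‖ ^ 2 = A.reApplyInnerSelf (x - y) + B.reApplyInnerSelf y := by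
    intro x y
    rw [WithLp.prod_norm_sq_eq_of_L2, ← norm_sqrt_apply_sq hA, ← norm_sqrt_apply_sq hB, map_sub]
    have h1 : (T x - R y).fst = CFC.sqrt A x - CFC.sqrt A y := rfl
    have h2 : (T x - R y).snd = 0 - CFC.sqrt B y := rfl
    rw [h1, h2, zero_sub, norm_neg]
  obtain ⟨S, hS, h⟩ := exists_operator_of_isGLB T R.range
  refine ⟨S, hS, fun x => ?_⟩
  have hr : (Set.range fun k : R.range => ‖T x - k‖ ^ 2) =
      Set.range fun y : H => A.reApplyInnerSelf (x - y) + B.reApplyInnerSelf y := by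
    ext r
    constructor
    · rintro ⟨⟨_, y, rfl⟩, rfl⟩
      exact ⟨y, (key x y).symm⟩
    · rintro ⟨y, rfl⟩
      exact ⟨⟨_, y, rfl⟩, key x y⟩
  have hx := h x
  rw [hr] at hx
  exact (hx.csInf_eq (Set.range_nonempty _)).symm

/-- The parallel sum `A : B`: the (unique) positive operator whose quadratic form is
`x ↦ inf {⟪A (x - y), x - y⟫ + ⟪B y, y⟫ | y ∈ H}`. -/
noncomputable def parallelSum {A B : H →L[ℂ] H} (hA : A.IsPositive) (hB : B.IsPositive) :
    H →L[ℂ] H :=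
  (exists_parallelSum hA hB).choose

theorem parallelSum_isPositive {A B : H →L[ℂ] H} (hA : A.IsPositive) (hB : B.IsPositive) :
    (parallelSum hA hB).IsPositive :=
  (exists_parallelSum hA hB).choose_spec.1

theorem parallelSum_reApplyInnerSelf {A B : H →L[ℂ] H} (hA : A.IsPositive) (hB : B.IsPositive)
    (x : H) : (parallelSum hA hB).reApplyInnerSelf x =
      ⨅ y : H, (A.reApplyInnerSelf (x - y) + B.reApplyInnerSelf y) :=
  (exists_parallelSum hA hB).choose_spec.2 x

theorem bddBelow_parallelSum {A B : H →L[ℂ] H} (hA : A.IsPositive) (hB : B.IsPositive) (x : H) :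
    BddBelow (Set.range fun y : H => A.reApplyInnerSelf (x - y) + B.reApplyInnerSelf y) :=
  ⟨0, Set.forall_mem_range.2 fun _ => add_nonneg (hA.2 _) (hB.2 _)⟩

theorem parallelSum_le_left {A B : H →L[ℂ] H} (hA : A.IsPositive) (hB : B.IsPositive) :
    parallelSum hA hB ≤ A := by
  rw [le_iff_reApplyInnerSelf_le (parallelSum_isPositive hA hB) hA]
  intro x
  rw [parallelSum_reApplyInnerSelf]
  refine (ciInf_le (bddBelow_parallelSum hA hB x) 0).trans ?_
  simp [ContinuousLinearMap.reApplyInnerSelf_apply]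

theorem parallelSum_mono_right {A B C : H →L[ℂ] H} (hA : A.IsPositive) (hB : B.IsPositive)
    (hC : C.IsPositive) (h : B ≤ C) : parallelSum hA hB ≤ parallelSum hA hC := by
  rw [le_iff_reApplyInnerSelf_le (parallelSum_isPositive hA hB) (parallelSum_isPositive hA hC)]
  intro x
  rw [parallelSum_reApplyInnerSelf, parallelSum_reApplyInnerSelf]
  refine ciInf_mono (bddBelow_parallelSum hA hB x) fun y => ?_
  have := (le_iff_reApplyInnerSelf_le hB hC).1 h y
  linarith

theorem nsmul_isPositive {B : H →L[ℂ] H} (hB : B.IsPositive) (n : ℕ) : (n • B).IsPositive := by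
  rw [← ContinuousLinearMap.nonneg_iff_isPositive] at hB ⊢
  exact nsmul_nonneg hB n

/-- A bounded increasing sequence of positive operators has a supremum, and its quadratic form is
the pointwise supremum of the quadratic forms. -/
theorem exists_isLUB_of_monotone {S : ℕ → H →L[ℂ] H} {A : H →L[ℂ] H}
    (hS : ∀ n, (S n).IsPositive) (hmono : Monotone S) (hle : ∀ n, S n ≤ A) :
    ∃ D : H →L[ℂ] H, D.IsPositive ∧ IsLUB (Set.range S) D ∧
      ∀ x, IsLUB (Set.range fun n => (S n).reApplyInnerSelf x) (D.reApplyInnerSelf x) := by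
  have hA : A.IsPositive := by
    rw [← ContinuousLinearMap.nonneg_iff_isPositive]
    exact ((ContinuousLinearMap.nonneg_iff_isPositive _).2 (hS 0)).trans (hle 0)
  have hqmono : ∀ x, Monotone fun n => (S n).reApplyInnerSelf x := fun x m n hmn =>
    (le_iff_reApplyInnerSelf_le (hS m) (hS n)).1 (hmono hmn) x
  have hqbdd : ∀ x, BddAbove (Set.range fun n => (S n).reApplyInnerSelf x) := fun x =>
    ⟨A.reApplyInnerSelf x, Set.forall_mem_range.2 fun n =>
      (le_iff_reApplyInnerSelf_le (hS n) hA).1 (hle n) x⟩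
  have hqlim : ∀ x, Filter.Tendsto (fun n => (S n).reApplyInnerSelf x) Filter.atTop
      (nhds (⨆ n, (S n).reApplyInnerSelf x)) := fun x =>
    tendsto_atTop_ciSup (hqmono x) (hqbdd x)
  have hest : ∀ x m n, m ≤ n → ‖S n x - S m x‖ ^ 2 ≤
      ‖A‖ * ((S n).reApplyInnerSelf x - (S m).reApplyInnerSelf x) := by
    intro x m n hmn
    have hD : (S n - S m).IsPositive := (ContinuousLinearMap.le_def _ _).1 (hmono hmn)
    have hD0 : 0 ≤ S n - S m := (ContinuousLinearMap.nonneg_iff_isPositive _).2 hD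
    have hDA : S n - S m ≤ A :=
      (sub_le_self _ ((ContinuousLinearMap.nonneg_iff_isPositive _).2 (hS m))).trans (hle n)
    have hnorm : ‖S n - S m‖ ≤ ‖A‖ := CStarAlgebra.norm_le_norm_of_nonneg_of_le hD0 hDA
    have hq : (S n - S m).reApplyInnerSelf x =
        (S n).reApplyInnerSelf x - (S m).reApplyInnerSelf x := by
      simp only [ContinuousLinearMap.reApplyInnerSelf_apply, sub_apply,
        inner_sub_left, map_sub]
    rw [← hq, ← sub_apply]
    generalize S n - S m = D at *
    have hmul : CFC.sqrt D * CFC.sqrt D = D := CFC.sqrt_mul_sqrt_self D hD0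
    have hDx : D x = CFC.sqrt D (CFC.sqrt D x) := by
      conv_lhs => rw [← hmul]
      rfl
    have hsn : ‖CFC.sqrt D‖ ^ 2 = ‖D‖ := by
      have h1 : star (CFC.sqrt D) = CFC.sqrt D := (sqrt_isPositive D).isSelfAdjoint
      have h2 := CStarRing.norm_star_mul_self (x := CFC.sqrt D)
      rw [h1, hmul] at h2
      rw [h2, sq]
    calc ‖D x‖ ^ 2 ≤ (‖CFC.sqrt D‖ * ‖CFC.sqrt D x‖) ^ 2 := by
          rw [hDx]
          exact pow_le_pow_left₀ (norm_nonneg _) (ContinuousLinearMap.le_opNorm _ _) 2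
      _ = ‖D‖ * D.reApplyInnerSelf x := by rw [mul_pow, hsn, norm_sqrt_apply_sq hD]
      _ ≤ ‖A‖ * D.reApplyInnerSelf x := mul_le_mul_of_nonneg_right hnorm (hD.2 x)
  have hcau : ∀ x, CauchySeq fun n => S n x := by
    intro x
    rw [Metric.cauchySeq_iff']
    intro ε hε
    set q := ⨆ n, (S n).reApplyInnerSelf x
    have hpos : 0 < ε ^ 2 / (‖A‖ + 1) := by positivity
    obtain ⟨N, hN⟩ := ((hqlim x).eventually (lt_mem_nhds (sub_lt_self q hpos))).exists
    refine ⟨N, fun n hn => ?_⟩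
    rw [dist_eq_norm]
    have h1 := hest x N n hn
    have h2 : (S n).reApplyInnerSelf x ≤ q := le_ciSup (hqbdd x) n
    have h3 : (S n).reApplyInnerSelf x - (S N).reApplyInnerSelf x < ε ^ 2 / (‖A‖ + 1) := by
      linarith
    have h4 : 0 ≤ (S n).reApplyInnerSelf x - (S N).reApplyInnerSelf x := sub_nonneg.2 (hqmono x hn)
    have h5 : ‖S n x - S N x‖ ^ 2 < ε ^ 2 := by
      rw [lt_div_iff₀ (by positivity)] at h3
      nlinarith [norm_nonneg A]
    exact lt_of_pow_lt_pow_left₀ 2 hε.le h5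
  choose f hf using fun x => cauchySeq_tendsto_of_complete (hcau x)
  let D : H →L[ℂ] H := continuousLinearMapOfTendsto (σ₁₂ := RingHom.id ℂ) S
    (tendsto_pi_nhds.2 hf)
  have hDf : ∀ x, Filter.Tendsto (fun n => S n x) Filter.atTop (nhds (D x)) := hf
  have hDq : ∀ x, Filter.Tendsto (fun n => (S n).reApplyInnerSelf x) Filter.atTop
      (nhds (D.reApplyInnerSelf x)) := by
    intro x
    simp only [ContinuousLinearMap.reApplyInnerSelf_apply]
    exact (RCLike.continuous_re.tendsto _).comp ((hDf x).inner tendsto_const_nhds)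
  have hDpos : D.IsPositive := by
    refine ⟨fun x y => ?_, fun x => ?_⟩
    · refine tendsto_nhds_unique ((hDf x).inner (tendsto_const_nhds (x := y))) ?_
      refine Filter.Tendsto.congr (fun n => ?_) ((tendsto_const_nhds (x := x)).inner (hDf y))
      exact ((hS n).inner_left_eq_inner_right x y).symm
    · exact ge_of_tendsto' (hDq x) fun n => (hS n).2 x
  have hlub : ∀ x, IsLUB (Set.range fun n => (S n).reApplyInnerSelf x) (D.reApplyInnerSelf x) :=
    fun x => isLUB_of_tendsto_atTop (hqmono x) (hDq x)
  refine ⟨D, hDpos, ⟨?_, ?_⟩, hlub⟩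
  · rintro _ ⟨n, rfl⟩
    exact (le_iff_reApplyInnerSelf_le (hS n) hDpos).2 fun x => (hlub x).1 ⟨n, rfl⟩
  · intro U hU
    have hUpos : U.IsPositive := by
      rw [← ContinuousLinearMap.nonneg_iff_isPositive]
      exact ((ContinuousLinearMap.nonneg_iff_isPositive _).2 (hS 0)).trans (hU ⟨0, rfl⟩)
    refine (le_iff_reApplyInnerSelf_le hDpos hUpos).2 fun x => (hlub x).2 ?_
    rintro _ ⟨n, rfl⟩
    exact (le_iff_reApplyInnerSelf_le (hS n) hUpos).1 (hU ⟨n, rfl⟩) x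

theorem exists_andoPart {A B : H →L[ℂ] H} (hA : A.IsPositive) (hB : B.IsPositive) :
    ∃ D : H →L[ℂ] H, D.IsPositive ∧
      IsLUB (Set.range fun n : ℕ => parallelSum hA (nsmul_isPositive hB n)) D ∧
      ∀ x, IsLUB (Set.range fun n : ℕ =>
        (parallelSum hA (nsmul_isPositive hB n)).reApplyInnerSelf x) (D.reApplyInnerSelf x) := by
  refine exists_isLUB_of_monotone (A := A) (fun n => parallelSum_isPositive hA _)
    (fun m n hmn => parallelSum_mono_right hA _ _ ?_) (fun n => parallelSum_le_left hA _)
  exact nsmul_le_nsmul_left ((ContinuousLinearMap.nonneg_iff_isPositive _).2 hB) hmn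

/-- Ando's operator `D_B A = sup_n (A : nB)`, the supremum being taken in the Loewner order. -/
noncomputable def andoPart {A B : H →L[ℂ] H} (hA : A.IsPositive) (hB : B.IsPositive) : H →L[ℂ] H :=
  (exists_andoPart hA hB).choose

theorem andoPart_isPositive {A B : H →L[ℂ] H} (hA : A.IsPositive) (hB : B.IsPositive) :
    (andoPart hA hB).IsPositive :=
  (exists_andoPart hA hB).choose_spec.1

theorem andoPart_isLUB {A B : H →L[ℂ] H} (hA : A.IsPositive) (hB : B.IsPositive) :
    IsLUB (Set.range fun n : ℕ => parallelSum hA (nsmul_isPositive hB n)) (andoPart hA hB) :=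
  (exists_andoPart hA hB).choose_spec.2.1

theorem andoPart_reApplyInnerSelf_isLUB {A B : H →L[ℂ] H} (hA : A.IsPositive) (hB : B.IsPositive)
    (x : H) : IsLUB (Set.range fun n : ℕ =>
      (parallelSum hA (nsmul_isPositive hB n)).reApplyInnerSelf x)
      ((andoPart hA hB).reApplyInnerSelf x) :=
  (exists_andoPart hA hB).choose_spec.2.2 x

end PosOp

/-! Everything is read off from quadratic forms. If `ran B` is closed, the open mapping theorem
gives every `B x` a preimage `z` with `‖z‖ ≤ C ‖B x‖`. Since `x - z ∈ ker B`, the short at `x` is at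
most `(A z | z) ≤ ‖A‖ C² ‖B x‖²`, and `‖B x‖² ≤ ‖B‖ (B x | x)`.

Always `D_B A ≤ A_{≪,B}`, while `D_B A` lies above every positive operator that is below `A` and
dominated by `B` (`reApplyInnerSelf_le_andoPart`). So once `A_{≪,B}` is dominated by `B`, it is such
an operator and the two parts coincide; this gives both (ii) → (iii) and the final equality.

For (iii) → (i) the single choice `A = 1` suffices: `D_B 1` does not shrink the form on `ran B`, so
domination yields `‖B z‖² ≤ c (B (B z) | B z)`. Hence `B` is bounded below on its range, which
forces the range to be closed. -/

namespace PosOp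

open ContinuousLinearMap

variable {H : Type*} [NormedAddCommGroup H] [InnerProductSpace ℂ H]

/-! ### Estimates for quadratic forms. -/

theorem reApplyInnerSelf_smul_left (c : ℝ) (B : H →L[ℂ] H) (x : H) :
    (c • B).reApplyInnerSelf x = c * B.reApplyInnerSelf x := by
  rw [reApplyInnerSelf_apply, reApplyInnerSelf_apply, smul_apply,
    ← Complex.coe_smul, inner_smul_left]
  simp

theorem reApplyInnerSelf_nsmul_left (n : ℕ) (B : H →L[ℂ] H) (x : H) :
    (n • B).reApplyInnerSelf x = n * B.reApplyInnerSelf x := by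
  rw [← Nat.cast_smul_eq_nsmul ℝ, reApplyInnerSelf_smul_left]

theorem reApplyInnerSelf_le_opNorm (A : H →L[ℂ] H) (x : H) :
    A.reApplyInnerSelf x ≤ ‖A‖ * ‖x‖ ^ 2 := by
  rw [reApplyInnerSelf_apply]
  calc RCLike.re (inner ℂ (A x) x) ≤ ‖A x‖ * ‖x‖ := re_inner_le_norm _ _
    _ ≤ ‖A‖ * ‖x‖ * ‖x‖ := by gcongr; exact A.le_opNorm x
    _ = ‖A‖ * ‖x‖ ^ 2 := by ring

theorem bddBelow_short {A : H →L[ℂ] H} (hA : A.IsPositive) (Y : Submodule ℂ H) (x : H) :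
    BddBelow (Set.range fun y : Y => A.reApplyInnerSelf (x - y)) :=
  ⟨0, Set.forall_mem_range.2 fun _ => hA.2 _⟩

variable [CompleteSpace H]

theorem smul_isPositive {B : H →L[ℂ] H} (hB : B.IsPositive) {c : ℝ} (hc : 0 ≤ c) :
    (c • B).IsPositive := by
  rw [← nonneg_iff_isPositive] at hB ⊢
  exact smul_nonneg hc hB

/-- Domination of positive operators, in terms of quadratic forms and a nonnegative constant. -/
theorem dominatedBy_iff {A B : H →L[ℂ] H} (hA : A.IsPositive) (hB : B.IsPositive) :
    DominatedBy A B ↔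
      ∃ c : ℝ, 0 ≤ c ∧ ∀ x, A.reApplyInnerSelf x ≤ c * B.reApplyInnerSelf x := by
  constructor
  · rintro ⟨c, hc⟩
    -- The constant in `DominatedBy` may be negative.
    refine ⟨|c|, abs_nonneg c, fun x => ?_⟩
    have h : c • B ≤ |c| • B :=
      smul_le_smul_of_nonneg_right (le_abs_self c) ((nonneg_iff_isPositive _).2 hB)
    rw [← reApplyInnerSelf_smul_left]
    exact (le_iff_reApplyInnerSelf_le hA (smul_isPositive hB (abs_nonneg c))).1 (hc.trans h) x
  · rintro ⟨c, hc, h⟩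
    refine ⟨c, (le_iff_reApplyInnerSelf_le hA (smul_isPositive hB hc)).2 fun x => ?_⟩
    rw [reApplyInnerSelf_smul_left]
    exact h x

theorem norm_sqrt_sq {B : H →L[ℂ] H} (hB : B.IsPositive) : ‖CFC.sqrt B‖ ^ 2 = ‖B‖ := by
  have h1 : star (CFC.sqrt B) = CFC.sqrt B := (sqrt_isPositive B).isSelfAdjoint
  have h2 := CStarRing.norm_star_mul_self (x := CFC.sqrt B)
  rw [h1, CFC.sqrt_mul_sqrt_self B ((nonneg_iff_isPositive _).2 hB)] at h2
  rw [h2, sq]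

theorem sqrt_apply_sqrt_apply {B : H →L[ℂ] H} (hB : B.IsPositive) (x : H) :
    CFC.sqrt B (CFC.sqrt B x) = B x := by
  rw [← mul_apply_eq_comp, CFC.sqrt_mul_sqrt_self B ((nonneg_iff_isPositive _).2 hB)]

theorem norm_apply_sq_le {B : H →L[ℂ] H} (hB : B.IsPositive) (x : H) :
    ‖B x‖ ^ 2 ≤ ‖B‖ * B.reApplyInnerSelf x := by
  rw [← sqrt_apply_sqrt_apply hB x, ← norm_sqrt_sq hB, ← norm_sqrt_apply_sq hB, ← mul_pow]
  exact pow_le_pow_left₀ (norm_nonneg _) (le_opNorm _ _) 2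

/-- Young's inequality for the form of a positive operator. -/
theorem two_mul_re_inner_le {B : H →L[ℂ] H} (hB : B.IsPositive) (x y : H) {t : ℝ} (ht : 0 < t) :
    2 * RCLike.re (inner ℂ (B x) y) ≤ t⁻¹ * B.reApplyInnerSelf x + t * B.reApplyInnerSelf y := by
  rw [← norm_sqrt_apply_sq hB, ← norm_sqrt_apply_sq hB, ← sqrt_apply_sqrt_apply hB x,
    (sqrt_isPositive B).inner_left_eq_inner_right]
  have h := re_inner_le_norm (𝕜 := ℂ) (CFC.sqrt B x) (CFC.sqrt B y)
  have h2 := two_mul_le_add_sq ‖CFC.sqrt B x‖ (t * ‖CFC.sqrt B y‖)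
  have h3 : t⁻¹ * (2 * ‖CFC.sqrt B x‖ * (t * ‖CFC.sqrt B y‖)) ≤
      t⁻¹ * (‖CFC.sqrt B x‖ ^ 2 + (t * ‖CFC.sqrt B y‖) ^ 2) := by gcongr
  field_simp at h3 ⊢
  nlinarith

/-! ### Comparison of the short with Ando's part. -/

theorem short_reApplyInnerSelf_le {A : H →L[ℂ] H} (hA : A.IsPositive) {Y : Submodule ℂ H}
    (x : H) {y : H} (hy : y ∈ Y) :
    (short hA Y).reApplyInnerSelf x ≤ A.reApplyInnerSelf (x - y) := by
  rw [short_reApplyInnerSelf]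
  exact ciInf_le (bddBelow_short hA Y x) ⟨y, hy⟩

theorem short_reApplyInnerSelf_le_self {A : H →L[ℂ] H} (hA : A.IsPositive) (Y : Submodule ℂ H)
    (x : H) : (short hA Y).reApplyInnerSelf x ≤ A.reApplyInnerSelf x := by
  simpa using short_reApplyInnerSelf_le hA x Y.zero_mem

/-- For `y ∈ ker B` the penalty `n (B y | y)` vanishes, so the infimum defining each `A : nB`
includes all competitors for the short. -/
theorem andoPart_reApplyInnerSelf_le_acPart {A B : H →L[ℂ] H} (hA : A.IsPositive)
    (hB : B.IsPositive) (x : H) :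
    (andoPart hA hB).reApplyInnerSelf x ≤ (acPart hA B).reApplyInnerSelf x := by
  refine (andoPart_reApplyInnerSelf_isLUB hA hB x).2 ?_
  rintro _ ⟨n, rfl⟩
  rw [acPart, short_reApplyInnerSelf]
  refine le_ciInf fun y => ?_
  have hy := (mem_ker_iff_reApplyInnerSelf_eq_zero hB (y : H)).1 y.2
  have h := ciInf_le (bddBelow_parallelSum hA (nsmul_isPositive hB n) x) (y : H)
  rw [← parallelSum_reApplyInnerSelf, reApplyInnerSelf_nsmul_left, hy, mul_zero, add_zero] at h
  exact h

theorem le_andoPart_reApplyInnerSelf {A B : H →L[ℂ] H} (hA : A.IsPositive) (hB : B.IsPositive)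
    {x : H} {r : ℝ} (n : ℕ)
    (h : ∀ y, r ≤ A.reApplyInnerSelf (x - y) + n * B.reApplyInnerSelf y) :
    r ≤ (andoPart hA hB).reApplyInnerSelf x := by
  refine le_trans ?_ ((andoPart_reApplyInnerSelf_isLUB hA hB x).1 ⟨n, rfl⟩)
  simp only [parallelSum_reApplyInnerSelf, reApplyInnerSelf_nsmul_left]
  exact le_ciInf h

/-- A positive operator below `A` and dominated by `B` is below the almost dominated part. -/
theorem reApplyInnerSelf_le_andoPart {A B S : H →L[ℂ] H} (hA : A.IsPositive) (hB : B.IsPositive)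
    (hS : S.IsPositive) (hSA : ∀ x, S.reApplyInnerSelf x ≤ A.reApplyInnerSelf x)
    (hSB : DominatedBy S B) (x : H) :
    S.reApplyInnerSelf x ≤ (andoPart hA hB).reApplyInnerSelf x := by
  obtain ⟨c, hc, hcB⟩ := (dominatedBy_iff hS hB).1 hSB
  -- The factor is `m / (m + 1)`, as in `S : mS = (m / (m + 1)) S`. Choosing `n ≥ m c` makes `mS ≤
  -- nB`; the factor tends to `1`.
  have key : ∀ m : ℕ, (1 - 1 / ((m : ℝ) + 1)) * S.reApplyInnerSelf x ≤
      (andoPart hA hB).reApplyInnerSelf x := by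
    intro m
    obtain ⟨n, hn⟩ := exists_nat_ge (m * c)
    refine le_andoPart_reApplyInnerSelf hA hB n fun y => ?_
    have h1 : S.reApplyInnerSelf x = S.reApplyInnerSelf (x - y) + S.reApplyInnerSelf y
        + 2 * RCLike.re (inner ℂ (S y) (x - y)) := by
      obtain ⟨z, rfl⟩ : ∃ z, x = z + y := ⟨x - y, by simp⟩
      have hsymm : RCLike.re (inner ℂ (S z) y) = RCLike.re (inner ℂ (S y) z) := by
        rw [hS.inner_left_eq_inner_right, inner_re_symm]
      simp only [reApplyInnerSelf_apply, add_sub_cancel_right, map_add, inner_add_left,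
        inner_add_right, hsymm]
      ring
    have h2 : (m : ℝ) * S.reApplyInnerSelf y ≤ n * B.reApplyInnerSelf y :=
      calc (m : ℝ) * S.reApplyInnerSelf y ≤ m * (c * B.reApplyInnerSelf y) := by
            gcongr
            exact hcB y
        _ = m * c * B.reApplyInnerSelf y := by ring
        _ ≤ n * B.reApplyInnerSelf y := mul_le_mul_of_nonneg_right hn (hB.2 y)
    have h3 := hSA (x - y)
    have h0 : 0 ≤ S.reApplyInnerSelf (x - y) := hS.2 _
    have h4 : (1 - 1 / ((m : ℝ) + 1)) * S.reApplyInnerSelf x ≤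
        S.reApplyInnerSelf (x - y) + m * S.reApplyInnerSelf y := by
      -- For `m = 0` the factor is `0`; otherwise Young's inequality with `t = 1 / m` bounds the
      -- cross term.
      rcases Nat.eq_zero_or_pos m with rfl | hm
      · simpa using h0
      · have hm' : (0 : ℝ) < m := by exact_mod_cast hm
        have h5 := two_mul_re_inner_le hS y (x - y) (inv_pos.2 hm')
        rw [inv_inv] at h5
        have h6 : S.reApplyInnerSelf x ≤
            (1 + (m : ℝ)⁻¹) * (S.reApplyInnerSelf (x - y) + m * S.reApplyInnerSelf y) := by
          have : (m : ℝ)⁻¹ * (m * S.reApplyInnerSelf y) = S.reApplyInnerSelf y := by field_simp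
          linarith
        have h7 : (1 - 1 / ((m : ℝ) + 1)) * (1 + (m : ℝ)⁻¹) = 1 := by
          field_simp
          ring
        have h8 : 0 ≤ 1 - 1 / ((m : ℝ) + 1) :=
          sub_nonneg.2 (div_le_one_of_le₀ (by linarith) (by linarith))
        have h9 := mul_le_mul_of_nonneg_left h6 h8
        rwa [← mul_assoc, h7, one_mul] at h9
    linarith
  have hlim : Filter.Tendsto (fun m : ℕ => (1 - 1 / ((m : ℝ) + 1)) * S.reApplyInnerSelf x)
      Filter.atTop (nhds ((1 - 0) * S.reApplyInnerSelf x)) :=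
    (tendsto_const_nhds.sub tendsto_one_div_add_atTop_nhds_zero_nat).mul_const _
  rw [sub_zero, one_mul] at hlim
  exact le_of_tendsto' hlim key

/-! ### Closed range and domination. -/

theorem acPart_dominatedBy_of_isClosed_range {A B : H →L[ℂ] H} (hA : A.IsPositive)
    (hB : B.IsPositive) (h : IsClosed (Set.range B)) : DominatedBy (acPart hA B) B := by
  have hcl : IsClosed (B.range : Set H) := by rwa [LinearMap.coe_range]
  have : CompleteSpace B.range := hcl.completeSpace_coe
  obtain ⟨C, hC, hpre⟩ :=
    B.rangeRestrict.exists_preimage_norm_le B.toLinearMap.surjective_rangeRestrict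
  refine (dominatedBy_iff (short_isPositive hA _) hB).2
    ⟨‖A‖ * C ^ 2 * ‖B‖, by positivity, fun x => ?_⟩
  obtain ⟨z, hz, hzn⟩ := hpre (B.rangeRestrict x)
  have hz' : B z = B x := congrArg Subtype.val hz
  have hzn' : ‖z‖ ≤ C * ‖B x‖ := hzn
  have hker : x - z ∈ B.ker := by
    change B (x - z) = 0
    rw [map_sub, hz', sub_self]
  calc (acPart hA B).reApplyInnerSelf x ≤ A.reApplyInnerSelf (x - (x - z)) :=
        short_reApplyInnerSelf_le hA x hker
    _ = A.reApplyInnerSelf z := by rw [sub_sub_cancel]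
    _ ≤ ‖A‖ * ‖z‖ ^ 2 := reApplyInnerSelf_le_opNorm A z
    _ ≤ ‖A‖ * (C * ‖B x‖) ^ 2 := by gcongr
    _ = ‖A‖ * C ^ 2 * ‖B x‖ ^ 2 := by ring
    _ ≤ ‖A‖ * C ^ 2 * (‖B‖ * B.reApplyInnerSelf x) := by gcongr; exact norm_apply_sq_le hB x
    _ = ‖A‖ * C ^ 2 * ‖B‖ * B.reApplyInnerSelf x := by ring

/-- Expanding `‖B z - y‖²`, the cross term `2 Re (B z | y)` is absorbed by the penalty on `y` at a
cost of `(B z | z) / (n + 1)`, which tends to `0`. -/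
theorem norm_sq_le_andoPart_one {B : H →L[ℂ] H} (hB : B.IsPositive) (z : H) :
    ‖B z‖ ^ 2 ≤ (andoPart (isPositive_one (𝕜 := ℂ) (E := H)) hB).reApplyInnerSelf (B z) := by
  have key : ∀ n : ℕ, ‖B z‖ ^ 2 - 1 / ((n : ℝ) + 1) * B.reApplyInnerSelf z ≤
      (andoPart (isPositive_one (𝕜 := ℂ) (E := H)) hB).reApplyInnerSelf (B z) := by
    intro n
    -- The weight `n + 1` is also the Young parameter, which must be positive.
    refine le_andoPart_reApplyInnerSelf _ hB (n + 1) fun y => ?_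
    have h1 := two_mul_re_inner_le hB z y (t := (n : ℝ) + 1) (by positivity)
    have h2 := norm_sub_sq (𝕜 := ℂ) (B z) y
    have h3 : (1 : H →L[ℂ] H).reApplyInnerSelf (B z - y) = ‖B z - y‖ ^ 2 := by
      rw [reApplyInnerSelf_apply, one_apply_eq_self, inner_self_eq_norm_sq]
    rw [h3, h2, one_div]
    push_cast
    nlinarith [sq_nonneg ‖y‖]
  have hlim : Filter.Tendsto
      (fun n : ℕ => ‖B z‖ ^ 2 - 1 / ((n : ℝ) + 1) * B.reApplyInnerSelf z)
      Filter.atTop (nhds (‖B z‖ ^ 2 - 0 * B.reApplyInnerSelf z)) :=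
    tendsto_const_nhds.sub (tendsto_one_div_add_atTop_nhds_zero_nat.mul_const _)
  rw [zero_mul, sub_zero] at hlim
  exact le_of_tendsto' hlim key

/-- A self-adjoint operator that is bounded below on its own range has closed range. -/
theorem isClosed_range_of_norm_le {B : H →L[ℂ] H} (hB : B.IsPositive) {c : ℝ} (hc : 0 ≤ c)
    (h : ∀ z, ‖B z‖ ≤ c * ‖B (B z)‖) : IsClosed (Set.range B) := by
  set K : Submodule ℂ H := B.range.topologicalClosure with hK
  have : CompleteSpace K := B.range.isClosed_topologicalClosure.completeSpace_coe
  have hbound : ∀ x ∈ K, ‖x‖ ≤ c * ‖B x‖ := by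
    have hcl : IsClosed {x : H | ‖x‖ ≤ c * ‖B x‖} := isClosed_le (by fun_prop) (by fun_prop)
    have hsub : (B.range : Set H) ⊆ {x : H | ‖x‖ ≤ c * ‖B x‖} := by
      rintro _ ⟨z, rfl⟩
      exact h z
    exact fun x hx => closure_minimal hsub hcl hx
  have hanti : AntilipschitzWith ⟨c, hc⟩ (B ∘L K.subtypeL) :=
    (B ∘L K.subtypeL).antilipschitz_of_bound fun x => hbound x x.2
  have hrange : Set.range B = Set.range (B ∘L K.subtypeL) := by
    refine Set.Subset.antisymm ?_ (by rintro _ ⟨x, rfl⟩; exact ⟨x, rfl⟩)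
    rintro _ ⟨x, rfl⟩
    refine ⟨⟨K.starProjection x, K.starProjection_apply_mem x⟩, ?_⟩
    -- With `w` the component of `x` orthogonal to `K`, `0 = (B (B w) | w) = ‖B w‖²`: discarding `w`
    -- does not change `B x`.
    have h0 : inner ℂ (B (B (x - K.starProjection x))) (x - K.starProjection x) = 0 :=
      Submodule.inner_right_of_mem_orthogonal
        (B.range.le_topologicalClosure ⟨B (x - K.starProjection x), rfl⟩)
        (K.sub_starProjection_mem_orthogonal x)
    rw [hB.inner_left_eq_inner_right, inner_self_eq_zero, map_sub, sub_eq_zero] at h0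
    exact h0.symm
  rw [hrange]
  exact hanti.isClosed_range (B ∘L K.subtypeL).uniformContinuous

theorem isClosed_range_of_andoPart_one_dominatedBy {B : H →L[ℂ] H} (hB : B.IsPositive)
    (h : DominatedBy (andoPart (isPositive_one (𝕜 := ℂ) (E := H)) hB) B) :
    IsClosed (Set.range B) := by
  obtain ⟨c, hc, hcB⟩ := (dominatedBy_iff (andoPart_isPositive _ hB) hB).1 h
  refine isClosed_range_of_norm_le hB hc fun z => ?_
  have h1 : ‖B z‖ ^ 2 ≤ c * (‖B (B z)‖ * ‖B z‖) :=
    (norm_sq_le_andoPart_one hB z).trans <| (hcB _).trans <|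
      mul_le_mul_of_nonneg_left (re_inner_le_norm _ _) hc
  rcases (norm_nonneg (B z)).eq_or_lt with h0 | h0
  · rw [← h0]
    positivity
  · exact le_of_mul_le_mul_right (by linarith) h0

theorem andoPart_eq_acPart_of_dominatedBy {A B : H →L[ℂ] H} (hA : A.IsPositive)
    (hB : B.IsPositive) (h : DominatedBy (acPart hA B) B) : andoPart hA hB = acPart hA B :=
  eq_of_reApplyInnerSelf_eq (andoPart_isPositive hA hB) (short_isPositive hA _) fun x =>
    (andoPart_reApplyInnerSelf_le_acPart hA hB x).antisymm
      (reApplyInnerSelf_le_andoPart hA hB (short_isPositive hA _)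
        (short_reApplyInnerSelf_le_self hA _) h x)

theorem andoPart_dominatedBy_of_acPart_dominatedBy {A B : H →L[ℂ] H} (hA : A.IsPositive)
    (hB : B.IsPositive) (h : DominatedBy (acPart hA B) B) : DominatedBy (andoPart hA hB) B := by
  rwa [andoPart_eq_acPart_of_dominatedBy hA hB h]

end PosOp

theorem mainTheorem5 {H : Type*} [NormedAddCommGroup H] [InnerProductSpace ℂ H] [CompleteSpace H]
    (B : H →L[ℂ] H) (hB : B.IsPositive) :
    List.TFAE
      [IsClosed (Set.range B),
        ∀ (A : H →L[ℂ] H) (hA : A.IsPositive), PosOp.DominatedBy (PosOp.acPart hA B) B,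
        ∀ (A : H →L[ℂ] H) (hA : A.IsPositive), PosOp.DominatedBy (PosOp.andoPart hA hB) B] ∧
    ((IsClosed (Set.range B) ∨
        (∀ (A : H →L[ℂ] H) (hA : A.IsPositive), PosOp.DominatedBy (PosOp.acPart hA B) B) ∨
        (∀ (A : H →L[ℂ] H) (hA : A.IsPositive), PosOp.DominatedBy (PosOp.andoPart hA hB) B)) →
      ∀ (A : H →L[ℂ] H) (hA : A.IsPositive), PosOp.andoPart hA hB = PosOp.acPart hA B) := by
  have h12 (h : IsClosed (Set.range B)) (A : H →L[ℂ] H) (hA : A.IsPositive) :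
      PosOp.DominatedBy (PosOp.acPart hA B) B :=
    PosOp.acPart_dominatedBy_of_isClosed_range hA hB h
  have h31 (h : ∀ (A : H →L[ℂ] H) (hA : A.IsPositive),
      PosOp.DominatedBy (PosOp.andoPart hA hB) B) : IsClosed (Set.range B) :=
    PosOp.isClosed_range_of_andoPart_one_dominatedBy hB (h _ _)
  constructor
  · tfae_have 1 → 2 := h12
    tfae_have 2 → 3 := fun h A hA =>
      PosOp.andoPart_dominatedBy_of_acPart_dominatedBy hA hB (h A hA)
    tfae_have 3 → 1 := h31
    tfae_finish
  · rintro (h | h | h) A hA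
    · exact PosOp.andoPart_eq_acPart_of_dominatedBy hA hB (h12 h A hA)
    · exact PosOp.andoPart_eq_acPart_of_dominatedBy hA hB (h A hA)
    · exact PosOp.andoPart_eq_acPart_of_dominatedBy hA hB (h12 (h31 h) A hA)
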